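/- Consider the two-armed Bayesian Gaussian bandit with infinite horizon and a discount factor $\gamma\in(0,1)$. An arm is in an informational state $(\Sigma,n)$, $\Sigma\in\mathbb R$, $n\in\{1,2,\dots\}$: its unknown mean reward $\theta$ has the law $N(\Sigma/n,1/n)$, a pull yields $Y\mid\theta\sim N(\theta,1)$ (so $Y\sim N(\Sigma/n,1+1/n)$), and after the reward $y$ the state of the pulled arm becomes $(\Sigma+y,n+1)$, while the other arm is unchanged. Write $\mu=\Sigma/n$. The Gittins index is $\nu^{GI}(\Sigma,n)=\lim_{t\to\infty}\nu_t(\Sigma,n)$, where $\nu_t(\Sigma,n)=\min\{\lambda: V_t(\Sigma,n,\lambda)=0\}$, $V_0=0$ and $V_t(\Sigma,n,\lambda)=\max\{\Sigma/n-\lambda+\gamma\,E[V_{t-1}(\Sigma+Y,n+1,\lambda)],\,0\}$. Each of the following policies always pulls an arm of maximal score (ties are broken in an arbitrary way that depends on the current state): * KG: the score of arm $a$ is $\mu_a+\frac{\gamma}{1-\gamma}\,E\left[\max_b\mu_b^{+1}-\max_b\mu_b\right]$, where $\mu_b^{+1}$ are the means after one pull of $a$. * GIBL (Brezzi and Lai):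 the score is $\mu+n^{-1/2}\,\psi\left(\frac{1}{n\log(1/\gamma)}\right)$, where $\psi(s)=\sqrt{s/2}$ for $s\le 0.2$; $0.49-0.11s^{-1/2}$ for $0.2<s\le 1$; $0.63-0.26s^{-1/2}$ for $1<s\le 5$; $0.77-0.58s^{-1/2}$ for $5<s\le 15$; $\sqrt{2\log s-\log\log s-\log 16\pi}$ for $s>15$. * GICG (Chick and Gans): the score is $\mu+\sqrt{\log(1/\gamma)}\;b\left(\frac{1}{n\log(1/\gamma)}\right)$, where $b(s)=s/\sqrt2$ for $s\le 1/7$; $\exp(-0.02645(\log s)^2+0.89106\log s-0.4873)$ for $1/7<s\le 100$; $\sqrt{s}\,\sqrt{2\log s-\log\log s-\log 16\pi}$ for $s>100$. A policy is index consistent if, once an arm is chosen, it continues to be chosen while its Gittins index remains above its value at the start of the period of continuation. Proposition. For every $\gamma\in(0,1)$, the policies KG, GIBL and GICG are not index consistent. More precisely, under each of them there are a state of the two arms and a reward of the arm pulled in that state such that the Gittins index of this arm rises, and yet the policy pulls the other arm next. -/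

import Mathlib

open MeasureTheory ProbabilityTheory Filter

noncomputable section

namespace GaussianBandit

/-! ### The two-armed Gaussian bandit with unit observation variance -/

/-- The informational state `(Σ, n)` of one arm: the unknown mean reward of the arm has the
law `N(Σ / n, 1 / n)`. -/
structure ArmState where
  /-- the hyper-parameter `Σ` -/
  total : ℝ
  /-- the precision `n` -/
  prec : ℕ+

/-- The mean reward `Σ / n` of an arm in state `(Σ, n)`. -/
def ArmState.mean (x : ArmState) : ℝ := x.total / (x.prec : ℝ)

/-- Bayesian updating after the reward `y`: `(Σ, n)` becomes `(Σ + y, n + 1)`. -/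
def ArmState.update (x : ArmState) (y : ℝ) : ArmState := ⟨x.total + y, x.prec + 1⟩

/-- The law `N(Σ / n, 1 / n)` of the unknown mean reward of an arm in state `(Σ, n)`. -/
def ArmState.belief (x : ArmState) : Measure ℝ :=
  gaussianReal x.mean (x.prec : NNReal)⁻¹

/-- The predictive law of the next reward `Y` of an arm in state `(Σ, n)`:
`Y | θ ∼ N(θ, 1)`, where `θ ∼ N(Σ / n, 1 / n)`. -/
def ArmState.predictive (x : ArmState) : Measure ℝ :=
  x.belief.bind fun θ => gaussianReal θ 1

/-- The predictive law is `N(Σ / n, 1 + 1 / n)`. -/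
theorem ArmState.predictive_eq (x : ArmState) :
    x.predictive = gaussianReal x.mean ((x.prec : NNReal)⁻¹ + 1) := by
  have h : ∀ θ : ℝ, gaussianReal θ 1 = (gaussianReal 0 1).map (θ + ·) := by
    intro θ
    rw [gaussianReal_map_const_add, zero_add]
  have hm : Measurable fun θ : ℝ => gaussianReal θ 1 := by
    refine Measure.measurable_of_measurable_coe _ fun s hs => ?_
    have : (fun θ : ℝ => gaussianReal θ 1 s)
        = fun θ : ℝ => (gaussianReal 0 1) (Prod.mk θ ⁻¹' ((fun p : ℝ × ℝ => p.1 + p.2) ⁻¹' s)) := by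
      funext θ
      rw [h θ, Measure.map_apply (by fun_prop) hs]
      rfl
    rw [this]
    exact measurable_measure_prodMk_left ((measurable_fst.add measurable_snd) hs)
  have hc := gaussianReal_conv_gaussianReal (m₁ := x.mean) (m₂ := 0)
    (v₁ := (x.prec : NNReal)⁻¹) (v₂ := 1)
  rw [add_zero] at hc
  rw [← hc]
  ext s hs
  rw [ArmState.predictive, Measure.bind_apply hs hm.aemeasurable, Measure.conv,
    Measure.map_apply (by fun_prop) hs,
    Measure.prod_apply (measurableSet_preimage (by fun_prop) hs), ArmState.belief]
  refine lintegral_congr fun θ => ?_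
  rw [h θ, Measure.map_apply (by fun_prop) hs]
  rfl

/-- The informational state of the two arms. -/
abbrev State := Fin 2 → ArmState

/-- The state after a pull of arm `a` that yields the reward `y`. -/
def pull (s : State) (a : Fin 2) (y : ℝ) : State :=
  Function.update s a ((s a).update y)

/-- The state after successive pulls of arm `a` that yield the rewards `ys`. -/
def pulls (s : State) (a : Fin 2) (ys : List ℝ) : State :=
  ys.foldl (fun s y => pull s a y) s

/-! ### The Gittins index -/

/-- The value function `V_t(Σ, n, γ, c)` with time `t` to go of the problem of stopping a single
arm, when every activation of the arm costs the charge `c`. -/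
def stoppingValue (γ c : ℝ) : ℕ → ArmState → ℝ
  | 0, _ => 0
  | t + 1, x =>
      max (x.mean - c + γ * ∫ y, stoppingValue γ c t (x.update y) ∂x.predictive) 0

/-- The index for the finite horizon `t`: the least charge at which the stopping problem is
worthless. -/
def horizonIndex (γ : ℝ) (t : ℕ) (x : ArmState) : ℝ :=
  sInf {c : ℝ | stoppingValue γ c t x = 0}

/-- The Gittins index of an arm, the limit of the finite-horizon indices. -/
def gittinsIndex (γ : ℝ) (x : ArmState) : ℝ :=
  limUnder atTop fun t : ℕ => horizonIndex γ t x

/-! ### Policies -/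

/-- A stationary policy `π` that always pulls an arm of maximal score; ties may be broken in any
way. -/
def IsScorePolicy (score : State → Fin 2 → ℝ) (π : State → Fin 2) : Prop :=
  ∀ s b, score s b ≤ score s (π s)

/-- The larger of the two mean rewards. -/
def maxMean (s : State) : ℝ := max (s 0).mean (s 1).mean

/-- The knowledge gradient of arm `a`: the expected increase in the maximal mean reward that
results from one pull of `a`. -/
def knowledgeGradient (s : State) (a : Fin 2) : ℝ :=
  ∫ y, (maxMean (pull s a y) - maxMean s) ∂(s a).predictive

/-- The KG score for the infinite horizon with discount factor `γ`. -/
def kgScore (γ : ℝ) (s : State) (a : Fin 2) : ℝ :=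
  (s a).mean + γ / (1 - γ) * knowledgeGradient s a

/-- The function `ψ` in the Gittins index approximation of Brezzi and Lai. -/
def brezziLaiPsi (s : ℝ) : ℝ :=
  if s ≤ 0.2 then √(s / 2)
  else if s ≤ 1 then 0.49 - 0.11 / √s
  else if s ≤ 5 then 0.63 - 0.26 / √s
  else if s ≤ 15 then 0.77 - 0.58 / √s
  else √(2 * Real.log s - Real.log (Real.log s) - Real.log (16 * Real.pi))

/-- The index of Brezzi and Lai: posterior mean plus posterior standard deviation times
`ψ (v / (-log γ))`, where `v = 1 / n` is the posterior variance. -/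
def gibl (γ : ℝ) (x : ArmState) : ℝ :=
  x.mean + √(1 / (x.prec : ℝ)) * brezziLaiPsi (1 / ((x.prec : ℝ) * -Real.log γ))

/-- The function `b` in the Gittins index approximation of Chick and Gans. -/
def chickGansB (s : ℝ) : ℝ :=
  if s ≤ 1 / 7 then s / √2
  else if s ≤ 100 then
    Real.exp (-0.02645 * Real.log s ^ 2 + 0.89106 * Real.log s - 0.4873)
  else √s * √(2 * Real.log s - Real.log (Real.log s) - Real.log (16 * Real.pi))

/-- The index of Chick and Gans: posterior mean plus `√(-log γ) * b (v / (-log γ))`, where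
`v = 1 / n` is the posterior variance. -/
def gicg (γ : ℝ) (x : ArmState) : ℝ :=
  x.mean + √(-Real.log γ) * chickGansB (1 / ((x.prec : ℝ) * -Real.log γ))

/-- The policy KG. -/
def IsKG (γ : ℝ) (π : State → Fin 2) : Prop := IsScorePolicy (kgScore γ) π

/-- The policy GIBL. -/
def IsGIBL (γ : ℝ) (π : State → Fin 2) : Prop := IsScorePolicy (fun s a => gibl γ (s a)) π

/-- The policy GICG. -/
def IsGICG (γ : ℝ) (π : State → Fin 2) : Prop := IsScorePolicy (fun s a => gicg γ (s a)) π

/-! ### Index consistency -/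

/-- Index consistency: once an arm is chosen (in state `s`), it continues to be chosen after
further pulls of it, as long as its Gittins index has remained, after each of these pulls, above
its value in `s`. -/
def IndexConsistent (γ : ℝ) (π : State → Fin 2) : Prop :=
  ∀ (s : State) (ys : List ℝ),
    (∀ zs : List ℝ, zs <+: ys → zs ≠ [] →
      gittinsIndex γ (s (π s)) < gittinsIndex γ (pulls s (π s) zs (π s))) →
    π (pulls s (π s) ys) = π s

/-- There are a state and a reward of the arm pulled there such that the Gittins index of this arm
rises, and yet the policy switches to the other arm. -/
def SwitchesAfterRise (γ : ℝ) (π : State → Fin 2) : Prop :=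
  ∃ (s : State) (y : ℝ),
    gittinsIndex γ (s (π s)) < gittinsIndex γ (pull s (π s) y (π s)) ∧
      π (pull s (π s) y) ≠ π s

end GaussianBandit

end

/-!
By translation invariance the Gittins index of an arm is its mean plus a premium `g n` that depends
on the precision only (`gittinsIndex_eq`). Every switch is found in the same configuration: two arms
in the same state `(0, n)`. Whichever arm the policy pulls, a reward can give it any new mean
`δ`, and its Gittins index rises if and only if `δ > g n - g (n + 1)`. It remains to find an `n` and
such a `δ` for which the pulled arm nevertheless gets the lower score
(`switchesAfterRise_of_score`). If there were none, then, summing over all higher precisions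
(`le_of_forall_sub_succ_le`), the premium `g n` would be at least as large as the total amount
by which the informational part of the score falls. Upper bounds of `g n` contradict this. They come
from supersolutions of the optimality equation (`excessValue_le_of_supersolution`); here one pull
moves the posterior mean by `σ Z`, where `σ = stepSd n = 1 / √(n (n + 1))` and `Z` is standard
Gaussian.

* GIBL and GICG. For large `n` both bonuses are equal to `1 / (n √(2 L))`, `L = log (1 / γ)`. The
  value function `x - c + c e ^ (-x / c)`, `x ≥ 0`, of the Brownian stopping problem is a
  supersolution for `c = stepSd n / √(2 L)`, so that `g n ≤ stepSd n / √(2 L)`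
  (`premium_le_brownian`), which is strictly smaller than the bonus.

* KG. Put `k = γ / (1 - γ)`. The knowledge gradient is an expected excess `E (σ Z - |δ|)⁺`
  (`knowledgeGradient_eq`), whose value for small `δ` is close to `σ E Z⁺`. So the policy switches
  if `δ` is less than about `k E Z⁺ (stepSd n - stepSd (n + 1))`, up to a relative error of order
  `1 / n ^ 2` (`expectedExcess_sub_ge`), and if it never did, then `g n` would be at least
  `k E Z⁺ stepSd n` up to such an error. The piecewise linear supersolution `(u + C n)⁺ / (1 - γ)`
  shows that `g n` is smaller than this by a relative amount of order `1 / n`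
  (`exists_premium_le`), because the step sizes decrease along the pulls.
-/

namespace GaussianBandit

/-! ### Integrals against the standard Gaussian law -/

theorem integrable_id_stdGaussian : Integrable (fun z : ℝ => z) (gaussianReal 0 1) :=
  (memLp_id_gaussianReal (μ := 0) (v := 1) 1).integrable le_rfl

theorem integral_stdGaussian_eq_zero : ∫ z, z ∂gaussianReal 0 1 = 0 :=
  integral_id_gaussianReal

theorem integrable_stdGaussian_of_lipschitzWith {K : NNReal} {f : ℝ → ℝ} (hf : LipschitzWith K f)
    (u σ : ℝ) : Integrable (fun z => f (u + σ * z)) (gaussianReal 0 1) := by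
  have hb : Integrable (fun z : ℝ => |f u| + K * |σ| * |z|) (gaussianReal 0 1) :=
    (integrable_const _).add (integrable_id_stdGaussian.abs.const_mul _)
  refine hb.mono' (hf.continuous.comp (by fun_prop)).aestronglyMeasurable
    (Eventually.of_forall fun z => ?_)
  have h := hf.dist_le_mul (u + σ * z) u
  rw [Real.dist_eq, Real.dist_eq, add_sub_cancel_left, abs_mul] at h
  have h2 := abs_sub_abs_le_abs_sub (f (u + σ * z)) (f u)
  rw [Real.norm_eq_abs]
  linarith

theorem lipschitzWith_posPart_add (c : ℝ) : LipschitzWith 1 fun x : ℝ => max (x + c) 0 :=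
  LipschitzWith.max_const (LipschitzWith.of_dist_le_mul fun x y => by simp) 0

theorem integral_exp_mul_stdGaussian (t : ℝ) :
    ∫ z, Real.exp (t * z) ∂gaussianReal 0 1 = Real.exp (t ^ 2 / 2) := by
  have h := mgf_gaussianReal (p := gaussianReal 0 1) (X := id) (μ := 0) (v := 1) Measure.map_id t
  simpa [mgf] using h

/-! ### The stopping problem in the coordinates (precision, mean minus charge) -/

/-- The standard deviation of the change of the posterior mean that one pull of an arm of
precision `n` brings about. -/
noncomputable def stepSd (n : ℕ) : ℝ := √(1 / ((n : ℝ) * (n + 1)))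

theorem stepSd_pos {n : ℕ} (hn : 1 ≤ n) : 0 < stepSd n := by
  have : (0 : ℝ) < n := by exact_mod_cast hn
  exact Real.sqrt_pos.2 (by positivity)

theorem stepSd_anti {m n : ℕ} (hm : 1 ≤ m) (h : m ≤ n) : stepSd n ≤ stepSd m := by
  have h1 : (0 : ℝ) < m := by exact_mod_cast hm
  have h2 : (m : ℝ) ≤ n := by exact_mod_cast h
  unfold stepSd
  gcongr

theorem stepSd_sq {n : ℕ} : stepSd n ^ 2 = 1 / ((n : ℝ) * (n + 1)) :=
  Real.sq_sqrt (by positivity)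

theorem stepSd_lt_one_div {n : ℕ} (hn : 1 ≤ n) : stepSd n < 1 / (n : ℝ) := by
  have h1 : (0 : ℝ) < n := by exact_mod_cast hn
  rw [stepSd, Real.sqrt_lt' (by positivity), div_pow, one_pow]
  gcongr
  nlinarith

theorem one_div_succ_le_stepSd {n : ℕ} (hn : 1 ≤ n) : 1 / ((n : ℝ) + 1) ≤ stepSd n := by
  have h1 : (0 : ℝ) < n := by exact_mod_cast hn
  rw [stepSd]
  refine Real.le_sqrt_of_sq_le ?_
  rw [div_pow, one_pow]
  gcongr
  nlinarith

theorem stepSd_ratio {n : ℕ} (hn : 1 ≤ n) :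
    (stepSd n - stepSd (n + 1)) / stepSd (n + 1) ≤ 1 / n := by
  have hn0 : (0 : ℝ) < n := by exact_mod_cast hn
  have h1 := stepSd_pos (Nat.le_succ_of_le hn)
  have h2 : stepSd n ≤ (1 + 1 / n) * stepSd (n + 1) := by
    refine Real.sqrt_le_iff.2 ⟨by positivity, ?_⟩
    rw [mul_pow, stepSd_sq]
    push_cast
    have h3 : (1 + 1 / (n : ℝ)) ^ 2 * (1 / ((n + 1) * (n + 1 + 1)))
        = 1 / (n * (n + 1)) * ((n + 1) ^ 2 / (n * (n + 2))) := by
      field_simp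
      ring
    rw [h3]
    refine le_mul_of_one_le_right (by positivity) ?_
    rw [one_le_div (by positivity)]
    nlinarith
  rw [div_le_iff₀ h1]
  linarith

theorem stepSd_succ_lt {n : ℕ} (hn : 1 ≤ n) : stepSd (n + 1) < stepSd n := by
  have h1 : (0 : ℝ) < n := by exact_mod_cast hn
  refine Real.sqrt_lt_sqrt (by positivity) ?_
  push_cast
  gcongr <;> linarith

theorem one_div_add_half_le_stepSd {n : ℕ} (hn : 1 ≤ n) : 1 / ((n : ℝ) + 1 / 2) ≤ stepSd n := by
  have h1 : (0 : ℝ) < n := by exact_mod_cast hn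
  refine Real.le_sqrt_of_sq_le ?_
  rw [div_pow, one_pow]
  gcongr
  nlinarith

theorem tendsto_stepSd : Tendsto stepSd atTop (nhds 0) := by
  refine squeeze_zero' (g := fun n : ℕ => 1 / (n : ℝ))
    (Eventually.of_forall fun n => Real.sqrt_nonneg _)
    (eventually_atTop.2 ⟨1, fun n hn => (stepSd_lt_one_div hn).le⟩)
    tendsto_one_div_atTop_nhds_zero_nat

/-- One pull moves the posterior mean by `stepSd n` times a standard Gaussian variable. -/
theorem integral_update_mean (x : ArmState) (F : ℝ → ℝ) :
    ∫ y, F (x.update y).mean ∂x.predictive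
      = ∫ z, F (x.mean + stepSd x.prec * z) ∂gaussianReal 0 1 := by
  have hn : (0 : ℝ) < (x.prec : ℕ) := by exact_mod_cast x.prec.pos
  set n : ℝ := ((x.prec : ℕ) : ℝ) with hndef
  have hs : 0 < √(1 / n + 1) := Real.sqrt_pos.2 (by positivity)
  have hmap : x.predictive
      = (gaussianReal 0 1).map fun z => x.mean + √(1 / n + 1) * z := by
    have h1 : (fun z : ℝ => x.mean + √(1 / n + 1) * z)
        = (fun z => x.mean + z) ∘ fun z => √(1 / n + 1) * z := rfl
    rw [h1, ← Measure.map_map (by fun_prop) (by fun_prop), gaussianReal_map_const_mul,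
      gaussianReal_map_const_add, x.predictive_eq, mul_zero, zero_add, mul_one]
    congr 1
    apply NNReal.eq
    show _ = √(1 / n + 1) ^ 2
    rw [Real.sq_sqrt (by positivity)]
    simp [hndef]
  have hemb : MeasurableEmbedding fun z : ℝ => x.mean + √(1 / n + 1) * z :=
    (measurableEmbedding_addLeft x.mean).comp (measurableEmbedding_mulLeft₀ hs.ne')
  rw [hmap, hemb.integral_map]
  refine integral_congr_ae (Eventually.of_forall fun z => ?_)
  have hsd : √(1 / n + 1) = (n + 1) * stepSd x.prec := by
    rw [Real.sqrt_eq_iff_mul_self_eq (by positivity)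
      (mul_nonneg (by positivity) (stepSd_pos x.prec.pos).le)]
    have := stepSd_sq (n := x.prec)
    rw [← hndef] at this
    rw [show (n + 1) * stepSd x.prec * ((n + 1) * stepSd x.prec)
      = (n + 1) ^ 2 * stepSd x.prec ^ 2 by ring, this]
    field_simp
    ring
  have hmean : x.mean = x.total / n := by simp [ArmState.mean, hndef]
  have hup : ∀ y, (x.update y).mean = (x.total + y) / (n + 1) := by
    intro y
    simp [ArmState.mean, ArmState.update, hndef]
  simp only [hup]
  congr 1
  rw [hsd, hmean]
  field_simp
  ring

/-- The value of the stopping problem with `t` periods to go, as a function of the precision `n`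
and of the excess `u` of the mean over the charge. -/
noncomputable def excessValue (γ : ℝ) : ℕ → ℕ → ℝ → ℝ
  | 0, _, _ => 0
  | t + 1, n, u =>
      max (u + γ * ∫ z, excessValue γ t (n + 1) (u + stepSd n * z) ∂gaussianReal 0 1) 0

theorem stoppingValue_eq_excessValue (γ c : ℝ) (t : ℕ) (x : ArmState) :
    stoppingValue γ c t x = excessValue γ t x.prec (x.mean - c) := by
  induction t generalizing x with
  | zero => rfl
  | succ t ih =>
    simp only [stoppingValue, excessValue, ih]
    have h := integral_update_mean x fun m => excessValue γ t ((x.prec : ℕ) + 1) (m - c)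
    have h2 : ∀ y, ((x.update y).prec : ℕ) = (x.prec : ℕ) + 1 := fun y => rfl
    simp only [h2, h, sub_add_eq_add_sub]

theorem excessValue_nonneg (γ : ℝ) (t n : ℕ) (u : ℝ) : 0 ≤ excessValue γ t n u := by
  cases t with
  | zero => exact le_rfl
  | succ t => exact le_max_right _ _

theorem exists_lipschitzWith_excessValue (γ : ℝ) (t : ℕ) :
    ∃ K : NNReal, ∀ n, LipschitzWith K (excessValue γ t n) := by
  induction t with
  | zero => exact ⟨0, fun n => LipschitzWith.const 0⟩
  | succ t ih =>
    obtain ⟨K, hK⟩ := ih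
    refine ⟨1 + ‖γ‖₊ * K, fun n => ?_⟩
    have hI : LipschitzWith (‖γ‖₊ * K) fun u : ℝ =>
        γ * ∫ z, excessValue γ t (n + 1) (u + stepSd n * z) ∂gaussianReal 0 1 := by
      refine LipschitzWith.of_dist_le_mul fun u v => ?_
      rw [Real.dist_eq, ← mul_sub, abs_mul,
        ← integral_sub (integrable_stdGaussian_of_lipschitzWith (hK _) _ _)
          (integrable_stdGaussian_of_lipschitzWith (hK _) _ _),
        NNReal.coe_mul, coe_nnnorm, Real.norm_eq_abs, mul_assoc]
      gcongr
      rw [← Real.norm_eq_abs]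
      have := norm_integral_le_of_norm_le_const (μ := gaussianReal 0 1) (C := K * dist u v)
        (f := fun z => excessValue γ t (n + 1) (u + stepSd n * z)
          - excessValue γ t (n + 1) (v + stepSd n * z))
        (Eventually.of_forall fun z => by
          have := (hK (n + 1)).dist_le_mul (u + stepSd n * z) (v + stepSd n * z)
          rwa [dist_add_right] at this)
      simpa using this
    exact (LipschitzWith.id.add hI).max_const 0

theorem integrable_excessValue (γ : ℝ) (t n : ℕ) (u σ : ℝ) :
    Integrable (fun z => excessValue γ t n (u + σ * z)) (gaussianReal 0 1) := by
  obtain ⟨K, hK⟩ := exists_lipschitzWith_excessValue γ t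
  exact integrable_stdGaussian_of_lipschitzWith (hK n) u σ

theorem excessValue_le_succ {γ : ℝ} (hγ : 0 ≤ γ) (t n : ℕ) (u : ℝ) :
    excessValue γ t n u ≤ excessValue γ (t + 1) n u := by
  induction t generalizing n u with
  | zero => exact excessValue_nonneg _ _ _ _
  | succ t ih =>
    rw [excessValue, excessValue]
    gcongr
    · exact integrable_excessValue ..
    · exact integrable_excessValue ..
    · exact fun z => ih _ _

/-- A nonnegative supersolution of the optimality equation dominates the value function. -/
theorem excessValue_le_of_supersolution {γ : ℝ} (hγ : 0 ≤ γ) {N : ℕ} {W : ℕ → ℝ → ℝ}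
    (hW0 : ∀ n u, 0 ≤ W n u)
    (hWi : ∀ n u σ, Integrable (fun z => W n (u + σ * z)) (gaussianReal 0 1))
    (hW : ∀ n, N ≤ n → ∀ u,
      u + γ * ∫ z, W (n + 1) (u + stepSd n * z) ∂gaussianReal 0 1 ≤ W n u)
    (t n : ℕ) (hn : N ≤ n) (u : ℝ) : excessValue γ t n u ≤ W n u := by
  induction t generalizing n u with
  | zero => exact hW0 n u
  | succ t ih =>
    refine max_le ((?_ : _ ≤ _).trans (hW n hn u)) (hW0 n u)
    gcongr
    · exact integrable_excessValue ..
    · exact hWi ..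
    · exact fun z => ih _ (by omega) _

/-! ### The Gittins index as mean plus premium -/

/-- The amount by which the index for the horizon `t` exceeds the mean, at precision `n`. -/
noncomputable def horizonPremium (γ : ℝ) (t n : ℕ) : ℝ := sInf {c : ℝ | excessValue γ t n (-c) = 0}

/-- The amount by which the Gittins index exceeds the mean, at precision `n`. -/
noncomputable def premium (γ : ℝ) (n : ℕ) : ℝ := limUnder atTop fun t => horizonPremium γ t n

theorem le_of_excessValue_eq_zero {γ : ℝ} (hγ : 0 ≤ γ) {t n : ℕ} {c : ℝ}
    (h : excessValue γ (t + 1) n (-c) = 0) : 0 ≤ c := by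
  have h1 := (le_max_left _ _).trans_eq h
  have h2 : 0 ≤ γ * ∫ z, excessValue γ t (n + 1) (-c + stepSd n * z) ∂gaussianReal 0 1 :=
    mul_nonneg hγ (integral_nonneg fun z => excessValue_nonneg ..)
  linarith

theorem horizonPremium_le {γ : ℝ} (hγ : 0 ≤ γ) {t n : ℕ} {c : ℝ}
    (h : excessValue γ (t + 1) n (-c) = 0) : horizonPremium γ (t + 1) n ≤ c :=
  csInf_le ⟨0, fun _ hc => le_of_excessValue_eq_zero hγ hc⟩ h

theorem horizonPremium_nonneg {γ : ℝ} (hγ : 0 ≤ γ) (t n : ℕ) :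
    0 ≤ horizonPremium γ (t + 1) n :=
  Real.sInf_nonneg fun _ hc => le_of_excessValue_eq_zero hγ hc

/-- If some charge makes the stopping problem worthless at every horizon, then the limit that
defines the premium exists. -/
theorem tendsto_horizonPremium {γ : ℝ} (hγ : 0 ≤ γ) {n : ℕ} {c : ℝ}
    (h : ∀ t, excessValue γ t n (-c) = 0) :
    Tendsto (fun t => horizonPremium γ t n) atTop (nhds (premium γ n)) := by
  have hmono : Monotone fun t => horizonPremium γ (t + 1) n := by
    refine monotone_nat_of_le_succ fun t => ?_
    refine csInf_le_csInf ⟨0, fun _ hc => le_of_excessValue_eq_zero hγ hc⟩ ⟨c, h _⟩ fun d hd => ?_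
    exact le_antisymm ((excessValue_le_succ hγ _ _ _).trans_eq hd) (excessValue_nonneg ..)
  have hbdd : BddAbove (Set.range fun t => horizonPremium γ (t + 1) n) :=
    ⟨c, by rintro _ ⟨t, rfl⟩; exact horizonPremium_le hγ (h _)⟩
  exact tendsto_nhds_limUnder ⟨_, (tendsto_add_atTop_iff_nat 1).1 (tendsto_atTop_ciSup hmono hbdd)⟩

theorem premium_le {γ : ℝ} (hγ : 0 ≤ γ) {n : ℕ} {c : ℝ}
    (h : ∀ t, excessValue γ t n (-c) = 0) : premium γ n ≤ c :=
  le_of_tendsto ((tendsto_add_atTop_iff_nat 1).2 (tendsto_horizonPremium hγ h))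
    (Eventually.of_forall fun _ => horizonPremium_le hγ (h _))

/-- Translation invariance: the Gittins index is the mean plus a premium that depends on the
precision only. -/
theorem gittinsIndex_eq_mean_add_premium {γ : ℝ} (hγ : 0 ≤ γ) {x : ArmState} {c : ℝ}
    (h : ∀ t, excessValue γ t x.prec (-c) = 0) :
    gittinsIndex γ x = x.mean + premium γ x.prec := by
  refine Tendsto.limUnder_eq ((tendsto_add_atTop_iff_nat 1).1 ?_)
  refine Tendsto.congr (fun t => ?_)
    (((tendsto_add_atTop_iff_nat 1).2 (tendsto_horizonPremium hγ h)).const_add x.mean)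
  have h1 := (OrderIso.addLeft x.mean).map_csInf' (s := {c | excessValue γ (t + 1) x.prec (-c) = 0})
    ⟨c, h _⟩ ⟨0, fun _ hc => le_of_excessValue_eq_zero hγ hc⟩
  rw [OrderIso.addLeft_apply] at h1
  rw [horizonPremium, h1, horizonIndex]
  congr 1
  ext d
  simp only [Set.mem_image, Set.mem_ofPred_eq, OrderIso.addLeft_apply,
    stoppingValue_eq_excessValue]
  constructor
  · rintro ⟨e, he, rfl⟩
    simpa using he
  · intro hd
    exact ⟨d - x.mean, by simpa using hd, by ring⟩

/-! ### The premium of Brownian motion bounds the premium -/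

/-- The function `x - c + c e ^ (-x / c)` on the half-line, and zero to the left: up to a factor,
the value of stopping a Brownian motion that starts at a distance `x` above its stopping
boundary. -/
noncomputable def brownianValue (c x : ℝ) : ℝ := max x 0 - c + c * Real.exp (-1 / c * max x 0)

theorem brownianValue_of_nonpos {c x : ℝ} (hx : x ≤ 0) : brownianValue c x = 0 := by
  simp [brownianValue, hx]

theorem brownianValue_nonneg {c : ℝ} (hc : 0 < c) (x : ℝ) : 0 ≤ brownianValue c x := by
  have h := Real.add_one_le_exp (-1 / c * max x 0)
  have h2 := mul_le_mul_of_nonneg_left h hc.le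
  have h3 : c * (-1 / c * max x 0 + 1) = c - max x 0 := by field_simp; ring
  unfold brownianValue
  linarith

theorem brownianValue_le {c : ℝ} (hc : 0 < c) (x : ℝ) :
    brownianValue c x ≤ x - c + c * Real.exp (-1 / c * x) := by
  rcases le_total 0 x with hx | hx
  · simp [brownianValue, hx]
  · rw [brownianValue_of_nonpos hx]
    have h := Real.add_one_le_exp (-1 / c * x)
    have h2 := mul_le_mul_of_nonneg_left h hc.le
    have h3 : c * (-1 / c * x + 1) = c - x := by field_simp; ring
    linarith

theorem brownianValue_mono {c : ℝ} (hc : 0 < c) : Monotone (brownianValue c) := by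
  intro x y hxy
  unfold brownianValue
  set a := max x 0
  set b := max y 0
  have hab : a ≤ b := max_le_max_right 0 hxy
  have ha : 0 ≤ a := le_max_right _ _
  -- the tangent line of the exponential function at `-a / c`
  have h1 := Real.add_one_le_exp (-1 / c * (b - a))
  have h2 : Real.exp (-1 / c * b) = Real.exp (-1 / c * a) * Real.exp (-1 / c * (b - a)) := by
    rw [← Real.exp_add]; ring_nf
  have h3 : Real.exp (-1 / c * a) ≤ 1 := by
    rw [Real.exp_le_one_iff]
    have : 0 ≤ 1 / c * a := by positivity
    have h : -1 / c * a = -(1 / c * a) := by ring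
    linarith
  have h4 : 0 < Real.exp (-1 / c * a) := Real.exp_pos _
  have h5 : c * (-1 / c * (b - a) + 1) = c - (b - a) := by field_simp; ring
  have h6 := mul_le_mul_of_nonneg_left h1 (mul_pos hc h4).le
  have h7 : c * Real.exp (-1 / c * a) * (-1 / c * (b - a) + 1)
      = Real.exp (-1 / c * a) * (c - (b - a)) := by rw [← h5]; ring
  rw [h2]
  nlinarith

theorem integrable_brownianValue {c : ℝ} (hc : 0 < c) (u σ : ℝ) :
    Integrable (fun z => brownianValue c (u + σ * z)) (gaussianReal 0 1) := by
  have hb : Integrable (fun z : ℝ => |u| + |σ| * |z|) (gaussianReal 0 1) :=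
    (integrable_const _).add (integrable_id_stdGaussian.abs.const_mul _)
  refine hb.mono' (((brownianValue_mono hc).measurable).comp (by fun_prop)).aestronglyMeasurable
    (Eventually.of_forall fun z => ?_)
  rw [Real.norm_eq_abs, abs_of_nonneg (brownianValue_nonneg hc _)]
  have h1 : brownianValue c (u + σ * z) ≤ |u + σ * z| := by
    have h2 : max (u + σ * z) 0 ≤ |u + σ * z| := max_le (le_abs_self _) (abs_nonneg _)
    have h3 : Real.exp (-1 / c * max (u + σ * z) 0) ≤ 1 := by
      rw [Real.exp_le_one_iff]
      have : 0 ≤ 1 / c * max (u + σ * z) 0 := by positivity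
      have h : -1 / c * max (u + σ * z) 0 = -(1 / c * max (u + σ * z) 0) := by ring
      linarith
    unfold brownianValue
    nlinarith
  exact h1.trans ((abs_add_le _ _).trans_eq (by rw [abs_mul]))

/-- On the whole line `x - c + c e ^ (-x / c)` solves the optimality equation without stopping,
by the moment generating function of the Gaussian law; the truncation at zero only lowers the
right-hand side. -/
theorem brownianValue_supersolution {γ c σ : ℝ} (hγ₀ : 0 < γ) (hγ₁ : γ < 1) (hc : 0 < c)
    (hσ : γ * Real.exp (σ ^ 2 / (2 * c ^ 2)) ≤ 1) (x : ℝ) :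
    (1 - γ) * (x - c) + γ * ∫ z, brownianValue c (x + σ * z) ∂gaussianReal 0 1
      ≤ brownianValue c x := by
  have key : ∀ x, 0 ≤ x →
      (1 - γ) * (x - c) + γ * ∫ z, brownianValue c (x + σ * z) ∂gaussianReal 0 1
        ≤ brownianValue c x := by
    intro x hx
    have hexp : ∀ z, Real.exp (-1 / c * (x + σ * z))
        = Real.exp (-1 / c * x) * Real.exp (-σ / c * z) := by
      intro z; rw [← Real.exp_add]; ring_nf
    have hi1 : Integrable (fun z : ℝ => x - c + σ * z) (gaussianReal 0 1) :=
      (integrable_const _).add (integrable_id_stdGaussian.const_mul _)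
    have hi2 : Integrable (fun z => c * Real.exp (-1 / c * x) * Real.exp (-σ / c * z))
        (gaussianReal 0 1) := (integrable_exp_mul_gaussianReal _).const_mul _
    have h1 : ∫ z, brownianValue c (x + σ * z) ∂gaussianReal 0 1
        ≤ ∫ z, ((x - c + σ * z) + c * Real.exp (-1 / c * x) * Real.exp (-σ / c * z))
          ∂gaussianReal 0 1 := by
      refine integral_mono (integrable_brownianValue hc _ _) (hi1.add hi2) fun z => ?_
      refine (brownianValue_le hc _).trans_eq ?_
      rw [hexp]; ring
    rw [integral_add hi1 hi2, integral_add (integrable_const _)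
      (integrable_id_stdGaussian.const_mul _), integral_const_mul, integral_const_mul,
      integral_exp_mul_stdGaussian, integral_stdGaussian_eq_zero] at h1
    have h2 : (-σ / c) ^ 2 / 2 = σ ^ 2 / (2 * c ^ 2) := by field_simp
    rw [h2] at h1
    simp only [integral_const, probReal_univ, smul_eq_mul, one_mul, mul_zero, add_zero] at h1
    have h3 := mul_le_mul_of_nonneg_left h1 hγ₀.le
    have h4 := mul_le_mul_of_nonneg_left hσ (mul_pos hc (Real.exp_pos (-1 / c * x))).le
    rw [brownianValue, max_eq_left hx]
    nlinarith
  rcases le_total 0 x with hx | hx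
  · exact key x hx
  · have h0 := key 0 le_rfl
    rw [brownianValue_of_nonpos le_rfl] at h0
    rw [brownianValue_of_nonpos hx]
    have h1 : ∫ z, brownianValue c (x + σ * z) ∂gaussianReal 0 1
        ≤ ∫ z, brownianValue c (0 + σ * z) ∂gaussianReal 0 1 :=
      integral_mono (integrable_brownianValue hc _ _) (integrable_brownianValue hc _ _)
        fun z => brownianValue_mono hc (by linarith)
    have h3 := mul_le_mul_of_nonneg_left h1 hγ₀.le
    nlinarith

/-- At the charge `stepSd n / √(2 log (1 / γ))` above the mean, stopping at once is optimal. -/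
theorem excessValue_neg_brownian_eq_zero {γ : ℝ} (hγ₀ : 0 < γ) (hγ₁ : γ < 1) {n : ℕ} (hn : 1 ≤ n)
    (t : ℕ) : excessValue γ t n (-(stepSd n / √(2 * -Real.log γ))) = 0 := by
  have hL : 0 < -Real.log γ := neg_pos.2 (Real.log_neg hγ₀ hγ₁)
  have hsd := stepSd_pos hn
  set c := stepSd n / √(2 * -Real.log γ) with hcdef
  have hc : 0 < c := div_pos hsd (Real.sqrt_pos.2 (by linarith))
  have hc2 : c ^ 2 = stepSd n ^ 2 / (2 * -Real.log γ) := by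
    rw [hcdef, div_pow, Real.sq_sqrt (by linarith)]
  have h1γ : 0 < 1 - γ := by linarith
  refine le_antisymm ?_ (excessValue_nonneg ..)
  refine (excessValue_le_of_supersolution hγ₀.le (N := n)
    (W := fun _ u => brownianValue c (u + c) / (1 - γ))
    (fun _ u => div_nonneg (brownianValue_nonneg hc _) h1γ.le) (fun _ u σ => ?_)
    (fun m hm u => ?_) t n le_rfl _).trans_eq ?_
  · simp only [add_right_comm u _ c]
    exact (integrable_brownianValue hc _ _).div_const _
  · have hσ : γ * Real.exp (stepSd m ^ 2 / (2 * c ^ 2)) ≤ 1 := by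
      have h2 : stepSd m ^ 2 / (2 * c ^ 2) ≤ -Real.log γ := by
        rw [div_le_iff₀ (by positivity), hc2]
        have h3 : stepSd m ^ 2 ≤ stepSd n ^ 2 :=
          pow_le_pow_left₀ (stepSd_pos (hn.trans hm)).le (stepSd_anti hn hm) 2
        refine h3.trans_eq ?_
        field_simp
        exact (div_self (neg_pos.1 hL).ne).symm
      calc γ * Real.exp (stepSd m ^ 2 / (2 * c ^ 2)) ≤ γ * Real.exp (-Real.log γ) := by gcongr
        _ = 1 := by rw [Real.exp_neg, Real.exp_log hγ₀, mul_inv_cancel₀ hγ₀.ne']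
    have h := brownianValue_supersolution hγ₀ hγ₁ hc hσ (u + c)
    simp only [add_right_comm u _ c]
    rw [integral_div, le_div_iff₀ h1γ]
    refine le_trans (le_of_eq ?_) h
    field_simp
    ring
  · simp [brownianValue]

theorem premium_le_brownian {γ : ℝ} (hγ₀ : 0 < γ) (hγ₁ : γ < 1) {n : ℕ} (hn : 1 ≤ n) :
    premium γ n ≤ stepSd n / √(2 * -Real.log γ) :=
  premium_le hγ₀.le (excessValue_neg_brownian_eq_zero hγ₀ hγ₁ hn)

theorem premium_nonneg {γ : ℝ} (hγ₀ : 0 < γ) (hγ₁ : γ < 1) {n : ℕ} (hn : 1 ≤ n) :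
    0 ≤ premium γ n :=
  ge_of_tendsto ((tendsto_add_atTop_iff_nat 1).2
    (tendsto_horizonPremium hγ₀.le (excessValue_neg_brownian_eq_zero hγ₀ hγ₁ hn)))
    (Eventually.of_forall fun _ => horizonPremium_nonneg hγ₀.le _ _)

theorem gittinsIndex_eq {γ : ℝ} (hγ₀ : 0 < γ) (hγ₁ : γ < 1) (x : ArmState) :
    gittinsIndex γ x = x.mean + premium γ x.prec :=
  gittinsIndex_eq_mean_add_premium hγ₀.le
    (excessValue_neg_brownian_eq_zero hγ₀ hγ₁ x.prec.pos)

/-! ### Switching away from one of two arms in the same state -/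

theorem SwitchesAfterRise.not_indexConsistent {γ : ℝ} {π : State → Fin 2}
    (h : SwitchesAfterRise γ π) : ¬ IndexConsistent γ π := by
  obtain ⟨s, y, hrise, hne⟩ := h
  refine fun hc => hne (hc s [y] fun zs hzs hzs0 => ?_)
  obtain rfl : zs = [y] := by
    rcases List.prefix_cons_iff.1 hzs with h | ⟨l, rfl, hl⟩
    · exact absurd h hzs0
    · rw [List.prefix_nil.1 hl]
  exact hrise

/-- The state of two arms of precision `n` and mean zero. -/
def twinState (n : ℕ+) : State := fun _ => ⟨0, n⟩

/-- The reward `(n + 1) δ` of arm `a` of the twin state makes `δ` its mean. -/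
theorem pull_twinState_same (n : ℕ+) (δ : ℝ) (a : Fin 2) :
    (pull (twinState n) a ((n + 1) * δ) a).mean = δ ∧
      (pull (twinState n) a ((n + 1) * δ) a).prec = n + 1 := by
  have : ((n : ℕ) : ℝ) + 1 ≠ 0 := by positivity
  constructor
  · simp only [pull, Function.update_self, ArmState.mean, ArmState.update, twinState, zero_add,
      PNat.add_coe, PNat.one_coe, Nat.cast_add, Nat.cast_one]
    field_simp
  · simp [pull, ArmState.update, twinState]

theorem pull_twinState_other (n : ℕ+) (y : ℝ) {a b : Fin 2} (hab : b ≠ a) :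
    pull (twinState n) a y b = ⟨0, n⟩ := by
  simp [pull, twinState, hab]

/-- A policy by scores switches if a mean that makes up for the loss of premium still leaves the
pulled twin with the lower score; ties in the twin state do not matter, because its two arms play
the same role. -/
theorem switchesAfterRise_of_score {γ : ℝ} (hγ₀ : 0 < γ) (hγ₁ : γ < 1)
    {score : State → Fin 2 → ℝ} {π : State → Fin 2} (hπ : IsScorePolicy score π) (n : ℕ+) (δ : ℝ)
    (hδ : premium γ n - premium γ (n + 1) < δ)
    (hscore : ∀ a b, b ≠ a → score (pull (twinState n) a ((n + 1) * δ)) a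
      < score (pull (twinState n) a ((n + 1) * δ)) b) :
    SwitchesAfterRise γ π := by
  set a := π (twinState n) with ha
  refine ⟨twinState n, (n + 1) * δ, ?_, fun h => ?_⟩
  · rw [gittinsIndex_eq hγ₀ hγ₁, gittinsIndex_eq hγ₀ hγ₁, (pull_twinState_same n δ _).1,
      (pull_twinState_same n δ _).2]
    simp only [twinState, ArmState.mean, zero_div, PNat.add_coe, PNat.one_coe]
    linarith
  · obtain ⟨b, hb⟩ := exists_ne a
    have h1 := hπ (pull (twinState n) a ((n + 1) * δ)) b
    rw [h] at h1
    exact absurd (hscore a b hb) (not_lt.2 h1)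

/-- If a nonnegative sequence decreases at least as fast as one that tends to zero, then it
dominates the latter. -/
theorem le_of_forall_sub_succ_le {a b : ℕ → ℝ} {N : ℕ} (ha : ∀ n, N ≤ n → 0 ≤ a n)
    (hb : Tendsto b atTop (nhds 0)) (h : ∀ n, N ≤ n → b n - b (n + 1) ≤ a n - a (n + 1)) :
    b N ≤ a N := by
  have h1 : ∀ n, N ≤ n → b N - b n ≤ a N := by
    intro n hn
    have : b N - b n ≤ a N - a n := by
      induction n, hn using Nat.le_induction with
      | base => simp
      | succ n hn ih => linarith [h n hn]
    linarith [ha n hn]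
  have h2 : Tendsto (fun n => b N - b n) atTop (nhds (b N - 0)) := hb.const_sub _
  rw [sub_zero] at h2
  exact le_of_tendsto h2 (eventually_atTop.2 ⟨N, h1⟩)

/-! ### Index policies with the asymptotics of Brownian motion -/

/-- An index policy whose bonus is the diffusion limit `1 / (n √(2 log (1 / γ)))` at all high
precisions switches: the bonus exceeds the premium, both vanish as the precision grows, and so
the bonus must at some precision fall by more than the premium. -/
theorem switchesAfterRise_of_bonus {γ : ℝ} (hγ₀ : 0 < γ) (hγ₁ : γ < 1) {h : ℕ → ℝ}
    {index : ArmState → ℝ} (hindex : ∀ x, index x = x.mean + h x.prec) {N : ℕ}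
    (hN : ∀ n, N ≤ n → h n = 1 / (n * √(2 * -Real.log γ)))
    {π : State → Fin 2} (hπ : IsScorePolicy (fun s a => index (s a)) π) :
    SwitchesAfterRise γ π := by
  have hL : 0 < √(2 * -Real.log γ) :=
    Real.sqrt_pos.2 (by linarith [Real.log_neg hγ₀ hγ₁])
  obtain ⟨n, hn, hlt⟩ : ∃ n, 1 ≤ n ∧ premium γ n - premium γ (n + 1) < h n - h (n + 1) := by
    by_contra! hcon
    have hlim : Tendsto h atTop (nhds 0) := by
      have h1 : Tendsto (fun n : ℕ => 1 / ((n : ℝ) * √(2 * -Real.log γ))) atTop (nhds 0) :=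
        tendsto_const_nhds.div_atTop (tendsto_natCast_atTop_atTop.atTop_mul_const hL)
      exact h1.congr' (eventually_atTop.2 ⟨N, fun n hn => (hN n hn).symm⟩)
    have h1 : 1 ≤ max N 1 := le_max_right _ _
    have h2 := le_of_forall_sub_succ_le (a := premium γ) (N := max N 1)
      (fun n hn => premium_nonneg hγ₀ hγ₁ (h1.trans hn)) hlim fun n hn => hcon n (h1.trans hn)
    have h3 := premium_le_brownian hγ₀ hγ₁ h1
    rw [hN _ (le_max_left _ _), ← div_div] at h2
    have h4 := div_lt_div_of_pos_right (stepSd_lt_one_div h1) hL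
    linarith
  obtain ⟨δ, hδ₁, hδ₂⟩ := exists_between hlt
  lift n to ℕ+ using hn
  refine switchesAfterRise_of_score hγ₀ hγ₁ hπ n δ hδ₁ fun a b hab => ?_
  simp only [hindex]
  rw [(pull_twinState_same _ δ a).1, (pull_twinState_same _ δ a).2, pull_twinState_other _ _ hab]
  simp only [ArmState.mean, zero_div, PNat.add_coe, PNat.one_coe]
  linarith

theorem switchesAfterRise_of_isGIBL {γ : ℝ} (hγ₀ : 0 < γ) (hγ₁ : γ < 1) {π : State → Fin 2}
    (hπ : IsGIBL γ π) : SwitchesAfterRise γ π := by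
  have hL : 0 < -Real.log γ := neg_pos.2 (Real.log_neg hγ₀ hγ₁)
  obtain ⟨N, hN⟩ := exists_nat_ge (5 / -Real.log γ)
  refine switchesAfterRise_of_bonus hγ₀ hγ₁
    (h := fun n => √(1 / (n : ℝ)) * brezziLaiPsi (1 / ((n : ℝ) * -Real.log γ)))
    (fun x => rfl) (N := N) (fun n hn => ?_) hπ
  have h0 : (N : ℝ) ≤ n := by exact_mod_cast hn
  have h1 : 5 ≤ (n : ℝ) * -Real.log γ := (div_le_iff₀ hL).1 (hN.trans h0)
  have hn0 : (0 : ℝ) < n := (by positivity : 0 < 5 / -Real.log γ).trans_le (hN.trans h0)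
  have h2 : 1 / ((n : ℝ) * -Real.log γ) ≤ 0.2 := by
    rw [div_le_iff₀ (by linarith)]; linarith
  simp only [brezziLaiPsi, if_pos h2]
  rw [← Real.sqrt_mul (by positivity), show 1 / (n : ℝ) * (1 / (n * -Real.log γ) / 2)
      = 1 / (n ^ 2 * (2 * -Real.log γ)) by rw [div_div, div_mul_div_comm]; ring_nf,
    Real.sqrt_div zero_le_one, Real.sqrt_one, Real.sqrt_mul (by positivity),
    Real.sqrt_sq hn0.le]

theorem switchesAfterRise_of_isGICG {γ : ℝ} (hγ₀ : 0 < γ) (hγ₁ : γ < 1) {π : State → Fin 2}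
    (hπ : IsGICG γ π) : SwitchesAfterRise γ π := by
  have hL : 0 < -Real.log γ := neg_pos.2 (Real.log_neg hγ₀ hγ₁)
  obtain ⟨N, hN⟩ := exists_nat_ge (7 / -Real.log γ)
  refine switchesAfterRise_of_bonus hγ₀ hγ₁
    (h := fun n => √(-Real.log γ) * chickGansB (1 / ((n : ℝ) * -Real.log γ)))
    (fun x => rfl) (N := N) (fun n hn => ?_) hπ
  have h0 : (N : ℝ) ≤ n := by exact_mod_cast hn
  have h1 : 7 ≤ (n : ℝ) * -Real.log γ := (div_le_iff₀ hL).1 (hN.trans h0)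
  have hn0 : (0 : ℝ) < n := (by positivity : 0 < 7 / -Real.log γ).trans_le (hN.trans h0)
  have h2 : 1 / ((n : ℝ) * -Real.log γ) ≤ 1 / 7 := one_div_le_one_div_of_le (by norm_num) h1
  simp only [chickGansB, if_pos h2]
  rw [Real.sqrt_mul zero_le_two]
  have h3 : 0 < √(-Real.log γ) := Real.sqrt_pos.2 hL
  have h4 : 0 < √(2 : ℝ) := Real.sqrt_pos.2 two_pos
  rw [← Real.mul_self_sqrt hL.le]
  simp only [Real.sqrt_mul_self h3.le]
  field_simp

/-! ### The knowledge gradient as an expected excess -/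

/-- The expected excess `E (σ Z - e)⁺` of a Gaussian variable over the level `e`. -/
noncomputable def expectedExcess (e σ : ℝ) : ℝ := ∫ z, max (σ * z - e) 0 ∂gaussianReal 0 1

theorem integrable_excess (e σ : ℝ) :
    Integrable (fun z => max (σ * z - e) 0) (gaussianReal 0 1) := by
  simpa [neg_add_eq_sub] using
    integrable_stdGaussian_of_lipschitzWith (lipschitzWith_posPart_add 0) (-e) σ

theorem integral_neg_stdGaussian (f : ℝ → ℝ) :
    ∫ z, f (-z) ∂gaussianReal 0 1 = ∫ z, f z ∂gaussianReal 0 1 := by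
  have h := (MeasurableEquiv.neg ℝ).measurableEmbedding.integral_map
    (μ := gaussianReal 0 1) f
  have h2 : (gaussianReal 0 1).map (MeasurableEquiv.neg ℝ) = gaussianReal 0 1 := by
    have := gaussianReal_map_neg (μ := 0) (v := 1)
    rwa [neg_zero] at this
  rw [h2] at h
  exact h.symm

theorem maxMean_eq (s : State) {a b : Fin 2} (hab : b ≠ a) :
    maxMean s = max (s a).mean (s b).mean := by
  obtain ⟨rfl, rfl⟩ | ⟨rfl, rfl⟩ : (a = 0 ∧ b = 1) ∨ (a = 1 ∧ b = 0) := by omega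
  · rfl
  · exact max_comm _ _

/-- The knowledge gradient depends only on the precision of the arm and on the distance of the
two means: to pull the better arm is, by the symmetry of the Gaussian law, worth as much as to
pull an inferior arm of the same precision. -/
theorem knowledgeGradient_eq (s : State) {a b : Fin 2} (hab : b ≠ a) :
    knowledgeGradient s a
      = expectedExcess |(s a).mean - (s b).mean| (stepSd (s a).prec) := by
  have h1 : ∀ y, maxMean (pull s a y) - maxMean s
      = max ((s a).update y).mean (s b).mean - max (s a).mean (s b).mean := by
    intro y
    rw [maxMean_eq _ hab, maxMean_eq _ hab]
    simp [pull, hab]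
  simp only [knowledgeGradient, h1]
  rw [integral_update_mean (s a) fun m => max m (s b).mean - max (s a).mean (s b).mean]
  generalize (s a).mean = μ
  generalize (s b).mean = ν
  generalize stepSd _ = σ
  rcases le_total μ ν with h | h
  · refine integral_congr_ae (Eventually.of_forall fun z => ?_)
    simp only
    rw [max_eq_right h, abs_of_nonpos (by linarith), ← max_sub_sub_right, sub_self]
    congr 1
    ring
  · have h2 : ∀ z, max (μ + σ * z) ν - max μ ν = σ * z + max (σ * -z - |μ - ν|) 0 := by
      intro z
      rw [max_eq_left h, abs_of_nonneg (by linarith), ← max_sub_sub_right, ← max_add_add_left,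
        max_comm]
      congr 1 <;> ring
    simp only [h2]
    have h3 : Integrable (fun z => max (σ * -z - |μ - ν|) 0) (gaussianReal 0 1) := by
      simpa using integrable_excess |μ - ν| (-σ)
    rw [integral_add (integrable_id_stdGaussian.const_mul _) h3, integral_const_mul,
      integral_stdGaussian_eq_zero, mul_zero, zero_add,
      integral_neg_stdGaussian fun z => max (σ * z - |μ - ν|) 0, expectedExcess]

/-! ### Estimates of the expected excess -/

/-- The mean `E Z⁺` of the positive part of a standard Gaussian variable. -/
noncomputable def meanPosPart : ℝ := expectedExcess 0 1

/-- The mean of the positive part of a standard Gaussian variable, truncated at one. -/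
noncomputable def meanTruncPosPart : ℝ := ∫ z, min (max z 0) 1 ∂gaussianReal 0 1

theorem meanPosPart_eq : meanPosPart = ∫ z, max z 0 ∂gaussianReal 0 1 := by
  simp [meanPosPart, expectedExcess]

theorem integrable_posPart : Integrable (fun z : ℝ => max z 0) (gaussianReal 0 1) := by
  simpa using integrable_excess 0 1

theorem integrable_truncPosPart :
    Integrable (fun z : ℝ => min (max z 0) 1) (gaussianReal 0 1) :=
  integrable_posPart.inf (integrable_const 1)

theorem meanTruncPosPart_pos : 0 < meanTruncPosPart := by
  have hnonneg : ∀ z : ℝ, 0 ≤ min (max z 0) 1 := fun z => le_min (le_max_right _ _) zero_le_one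
  refine (integral_pos_iff_support_of_nonneg hnonneg integrable_truncPosPart).2 ?_
  have hsub : Set.Ioi (0 : ℝ) ⊆ Function.support fun z : ℝ => min (max z 0) 1 := by
    intro z hz
    have : 0 < min (max z 0) 1 := lt_min (lt_max_of_lt_left hz) one_pos
    exact this.ne'
  refine lt_of_lt_of_le ?_ (measure_mono hsub)
  have hac := gaussianReal_absolutelyContinuous' 0 (v := 1) one_ne_zero
  refine pos_iff_ne_zero.2 fun h0 => ?_
  have := hac h0
  simp at this

theorem meanPosPart_pos : 0 < meanPosPart := by
  refine meanTruncPosPart_pos.trans_le ?_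
  rw [meanPosPart_eq]
  exact integral_mono integrable_truncPosPart integrable_posPart fun z => min_le_left _ _

/-- For `e ≤ σ` the integrand `(σ z - e)⁺` is at most `σ z⁺ - e min(z⁺, 1)`, with equality for
`z ≥ 1`. -/
theorem expectedExcess_le {e σ : ℝ} (hσ : 0 ≤ σ) (he : 0 ≤ e) (heσ : e ≤ σ) :
    expectedExcess e σ ≤ σ * meanPosPart - e * meanTruncPosPart := by
  rw [meanPosPart_eq, meanTruncPosPart, ← integral_const_mul, ← integral_const_mul,
    ← integral_sub (integrable_posPart.const_mul _) (integrable_truncPosPart.const_mul _)]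
  refine integral_mono (integrable_excess e σ)
    ((integrable_posPart.const_mul _).sub (integrable_truncPosPart.const_mul _)) fun z => ?_
  simp only
  rcases le_total z 0 with hz | hz
  · rw [max_eq_right hz, min_eq_left zero_le_one]
    exact max_le (by nlinarith) (by linarith)
  · rw [max_eq_left hz]
    rcases le_total z 1 with hz1 | hz1
    · rw [min_eq_left hz1]
      exact max_le (by nlinarith) (by nlinarith)
    · rw [min_eq_right hz1]
      exact max_le (by nlinarith) (by nlinarith)

/-- The standard Gaussian density is at most one. -/
theorem stdGaussian_Icc_le {a : ℝ} (ha : 0 ≤ a) : (gaussianReal 0 1).real (Set.Icc 0 a) ≤ a := by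
  have h1 : gaussianReal 0 1 (Set.Icc 0 a) ≤ ENNReal.ofReal a := by
    rw [gaussianReal_apply 0 one_ne_zero]
    refine (setLIntegral_mono (g := fun _ => 1) measurable_const fun x _ => ?_).trans ?_
    · rw [gaussianPDF, ENNReal.ofReal_le_one, gaussianPDFReal]
      refine mul_le_one₀ (inv_le_one_of_one_le₀ ?_) (Real.exp_pos _).le ?_
      · rw [Real.one_le_sqrt, NNReal.coe_one, mul_one]
        linarith [Real.pi_gt_three]
      · rw [Real.exp_le_one_iff, NNReal.coe_one]
        have := sq_nonneg (x - 0)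
        linarith
    · simp
  exact ENNReal.toReal_le_of_le_ofReal ha h1

/-- The difference of the integrands is `(σ - τ) z` to the right of `e / τ` and nonnegative
everywhere; the part of `E Z⁺` that comes from `[0, e / τ]` is of second order in `e / τ`. -/
theorem expectedExcess_sub_ge {e σ τ : ℝ} (hτ : 0 < τ) (hτσ : τ ≤ σ) (he : 0 ≤ e) :
    (σ - τ) * (meanPosPart - (e / τ) ^ 2) ≤ expectedExcess e σ - expectedExcess e τ := by
  have ha : 0 ≤ e / τ := by positivity
  have hind : Integrable (fun z : ℝ => (e / τ) * (Set.Icc 0 (e / τ)).indicator 1 z)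
      (gaussianReal 0 1) := ((integrable_const 1).indicator measurableSet_Icc).const_mul _
  have h1 : ∫ z, (max z 0 - (e / τ) * (Set.Icc 0 (e / τ)).indicator 1 z) ∂gaussianReal 0 1
      = meanPosPart - (e / τ) * (gaussianReal 0 1).real (Set.Icc 0 (e / τ)) := by
    rw [integral_sub integrable_posPart hind, integral_const_mul,
      integral_indicator_one measurableSet_Icc, meanPosPart_eq]
  have h2 : meanPosPart - (e / τ) ^ 2
      ≤ ∫ z, (max z 0 - (e / τ) * (Set.Icc 0 (e / τ)).indicator 1 z) ∂gaussianReal 0 1 := by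
    rw [h1, sq]
    gcongr
    exact stdGaussian_Icc_le ha
  refine (mul_le_mul_of_nonneg_left h2 (sub_nonneg.2 hτσ)).trans ?_
  rw [expectedExcess, expectedExcess, ← integral_sub (integrable_excess _ _)
    (integrable_excess _ _), ← integral_const_mul]
  refine integral_mono ((integrable_posPart.sub hind).const_mul _)
    ((integrable_excess _ _).sub (integrable_excess _ _)) fun z => ?_
  simp only
  have heτ : e / τ * τ = e := div_mul_cancel₀ _ hτ.ne'
  rcases lt_or_ge z 0 with hz | hz
  · rw [Set.indicator_of_notMem (fun h => not_le.2 hz h.1), max_eq_right hz.le,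
      max_eq_right (by nlinarith : σ * z - e ≤ 0), max_eq_right (by nlinarith : τ * z - e ≤ 0)]
    simp
  · rw [max_eq_left hz]
    rcases le_or_gt z (e / τ) with hza | hza
    · rw [Set.indicator_of_mem (Set.mem_Icc.2 ⟨hz, hza⟩),
        max_eq_right (by nlinarith : τ * z - e ≤ 0), Pi.one_apply]
      have : 0 ≤ max (σ * z - e) 0 := le_max_right _ _
      nlinarith
    · rw [Set.indicator_of_notMem (fun h => not_le.2 hza h.2),
        max_eq_left (by nlinarith : 0 ≤ σ * z - e), max_eq_left (by nlinarith : 0 ≤ τ * z - e)]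
      linarith

/-! ### A sharper bound of the premium for high precisions -/

/-- The charge `C n` above the mean makes the stopping problem worthless if the value function is
dominated by the piecewise linear function `(u + C n)⁺ / (1 - γ)`. -/
theorem excessValue_neg_eq_zero_of_expectedExcess_le {γ : ℝ} (hγ₀ : 0 < γ) (hγ₁ : γ < 1) {N : ℕ}
    {C : ℕ → ℝ}
    (hC : ∀ n, N ≤ n → γ / (1 - γ) * expectedExcess (C n - C (n + 1)) (stepSd n) ≤ C n)
    (t n : ℕ) (hn : N ≤ n) : excessValue γ t n (-C n) = 0 := by
  have h1γ : 0 < 1 - γ := by linarith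
  have hWi : ∀ (n : ℕ) (u σ : ℝ),
      Integrable (fun z => max (u + σ * z + C n) 0) (gaussianReal 0 1) := fun n u σ =>
    integrable_stdGaussian_of_lipschitzWith (lipschitzWith_posPart_add (C n)) u σ
  refine le_antisymm ?_ (excessValue_nonneg ..)
  refine (excessValue_le_of_supersolution hγ₀.le (N := N)
    (W := fun n u => max (u + C n) 0 / (1 - γ))
    (fun _ u => div_nonneg (le_max_right _ _) h1γ.le) (fun n u σ => (hWi n u σ).div_const _)
    (fun m hm u => ?_) t n hn _).trans_eq (by simp)
  have h1 : ∫ z, max (u + stepSd m * z + C (m + 1)) 0 ∂gaussianReal 0 1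
      ≤ max (u + C m) 0 + expectedExcess (C m - C (m + 1)) (stepSd m) := by
    have h2 : ∫ z, (max (u + C m) 0 + max (stepSd m * z - (C m - C (m + 1))) 0) ∂gaussianReal 0 1
        = max (u + C m) 0 + expectedExcess (C m - C (m + 1)) (stepSd m) := by
      rw [integral_add (integrable_const _) (integrable_excess _ _)]
      simp [expectedExcess]
    rw [← h2]
    refine integral_mono (hWi _ _ _) ((integrable_const _).add (integrable_excess _ _))
      fun z => ?_
    refine max_le ?_ (add_nonneg (le_max_right _ _) (le_max_right _ _))
    have h3 := le_max_left (u + C m) 0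
    have h4 := le_max_left (stepSd m * z - (C m - C (m + 1))) 0
    linarith
  have hk : 0 < γ / (1 - γ) := div_pos hγ₀ h1γ
  have h5 := mul_le_mul_of_nonneg_left h1 hk.le
  have h6 := hC m hm
  have h7 : max (u + C m) 0 / (1 - γ) = max (u + C m) 0 + γ / (1 - γ) * max (u + C m) 0 := by
    field_simp
    ring
  have h8 := le_max_left (u + C m) 0
  rw [integral_div, h7, mul_div_assoc', mul_div_right_comm]
  linarith

/-- With `k = γ / (1 - γ)`, the decrease of the variances along the pulls improves the bound
`k E Z⁺ stepSd n` of the premium by a relative amount of order `1 / n`. -/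
theorem exists_premium_le {γ : ℝ} (hγ₀ : 0 < γ) (hγ₁ : γ < 1) :
    ∃ B : ℝ, 0 < B ∧ ∃ N : ℕ, ∀ n, N ≤ n →
      premium γ n ≤ γ / (1 - γ) * meanPosPart / (n + 1 / 2 + B) := by
  have hk : 0 < γ / (1 - γ) := div_pos hγ₀ (by linarith)
  have hm := meanPosPart_pos
  have hq := meanTruncPosPart_pos
  set k := γ / (1 - γ) with hkdef
  set q := meanTruncPosPart
  -- to leading order the linear supersolution needs `B ≤ k q`; half of that leaves room for the
  -- terms of lower order
  set B := k * q / 2 with hB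
  have hB0 : 0 < B := by positivity
  set θ := 1 / 2 + B with hθ
  have hθ0 : 0 < θ := by positivity
  set c₀ := k * meanPosPart with hc₀
  have hc₀0 : 0 < c₀ := by positivity
  obtain ⟨N, hN⟩ := exists_nat_ge (c₀ + 1 + (B * θ + θ / 2 + θ * (1 + θ) / 2) / B)
  refine ⟨B, hB0, N, fun n hn => ?_⟩
  refine premium_le hγ₀.le fun t => excessValue_neg_eq_zero_of_expectedExcess_le hγ₀ hγ₁ (N := N)
    (C := fun n : ℕ => c₀ / (n + 1 / 2 + B)) (fun n hn => ?_) t n hn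
  rw [← hkdef, Nat.cast_add, Nat.cast_one]
  have hNn : (N : ℝ) ≤ n := by exact_mod_cast hn
  have hfrac : 0 < (B * θ + θ / 2 + θ * (1 + θ) / 2) / B := by positivity
  have hn1 : 1 ≤ (n : ℝ) := by linarith
  have hnc : c₀ ≤ n := by linarith
  have hn1' : 1 ≤ n := by exact_mod_cast hn1
  have hnB : B * θ + θ / 2 + θ * (1 + θ) / 2 ≤ n * B := by
    rw [← div_le_iff₀ hB0]; linarith
  have he : c₀ / ((n : ℝ) + 1 / 2 + B) - c₀ / ((n : ℝ) + 1 + 1 / 2 + B)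
      = c₀ / ((n + θ) * (n + 1 + θ)) := by
    rw [hθ]
    field_simp
    ring
  have hsd : stepSd n ≤ (n + 1 / 2) / ((n : ℝ) * (n + 1)) := by
    refine Real.sqrt_le_iff.2 ⟨by positivity, ?_⟩
    rw [div_pow, div_le_div_iff₀ (by positivity) (by positivity)]
    nlinarith [mul_pos (by linarith : (0 : ℝ) < n) (by linarith : (0 : ℝ) < n + 1)]
  have hes : c₀ / ((n + θ) * (n + 1 + θ)) ≤ stepSd n := by
    refine le_trans ?_ (one_div_succ_le_stepSd hn1')
    rw [div_le_div_iff₀ (by positivity) (by positivity)]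
    nlinarith [mul_pos hθ0 hθ0]
  rw [he]
  refine (mul_le_mul_of_nonneg_left
    (expectedExcess_le (stepSd_pos hn1').le (by positivity) hes) hk.le).trans ?_
  have hpoly : (n * B + θ / 2) * (n + 1 + θ) ≤ k * q * ((n : ℝ) * (n + 1)) := by
    have : k * q = 2 * B := by rw [hB]; ring
    rw [this]
    nlinarith [mul_le_mul_of_nonneg_left hnB (by linarith : (0 : ℝ) ≤ n),
      mul_nonneg (sub_nonneg.2 hn1) (by positivity : 0 ≤ θ * (1 + θ)),
      mul_nonneg hB0.le (by linarith : (0 : ℝ) ≤ n)]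
  have hmain : (n + 1 / 2) / ((n : ℝ) * (n + 1)) - k * q / ((n + θ) * (n + 1 + θ))
      ≤ 1 / (n + θ) := by
    have h1 : (n + 1 / 2) / ((n : ℝ) * (n + 1)) - 1 / (n + θ)
        = (n * B + θ / 2) * (n + 1 + θ) / ((n * (n + 1)) * ((n + θ) * (n + 1 + θ))) := by
      rw [hθ]
      field_simp
      ring
    have h2 : k * q / ((n + θ) * (n + 1 + θ))
        = k * q * ((n : ℝ) * (n + 1)) / ((n * (n + 1)) * ((n + θ) * (n + 1 + θ))) := by
      field_simp
    have h3 := div_le_div_of_nonneg_right hpoly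
      (by positivity : 0 ≤ ((n : ℝ) * (n + 1)) * ((n + θ) * (n + 1 + θ)))
    linarith
  have h4 := mul_le_mul_of_nonneg_left hmain hc₀0.le
  have h5 := mul_le_mul_of_nonneg_left hsd hc₀0.le
  have h6 : (n : ℝ) + 1 / 2 + B = n + θ := by rw [hθ]; ring
  rw [h6]
  calc k * (stepSd n * meanPosPart - c₀ / ((n + θ) * (n + 1 + θ)) * q)
      = c₀ * stepSd n - c₀ * (k * q / ((n + θ) * (n + 1 + θ))) := by rw [hc₀]; ring
    _ ≤ c₀ * (1 / (n + θ)) := by linarith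
    _ = c₀ / (n + θ) := by ring

/-! ### The knowledge gradient policy -/

theorem kgScore_pull_lt {γ : ℝ} {n : ℕ+} {δ : ℝ} (hδ : 0 ≤ δ)
    (h : δ + γ / (1 - γ) * expectedExcess δ (stepSd (n + 1))
      < γ / (1 - γ) * expectedExcess δ (stepSd n)) {a b : Fin 2} (hab : b ≠ a) :
    kgScore γ (pull (twinState n) a ((n + 1) * δ)) a
      < kgScore γ (pull (twinState n) a ((n + 1) * δ)) b := by
  rw [kgScore, kgScore, knowledgeGradient_eq _ hab, knowledgeGradient_eq _ hab.symm,
    (pull_twinState_same n δ a).1, (pull_twinState_same n δ a).2, pull_twinState_other _ _ hab]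
  simpa [ArmState.mean, abs_of_nonneg hδ] using h

/-- The two arms of the twin state differ, after a pull, by `k E Z⁺ (stepSd n - stepSd (n + 1))`
in the informational part of their scores, up to a relative error of order `1 / n ^ 2`. Were the
policy never to switch, then the premium would lose at least as much with each pull, and the sum
of these losses would exceed the bound of the premium, which is smaller by a relative amount of
order `1 / n`. -/
theorem switchesAfterRise_of_isKG {γ : ℝ} (hγ₀ : 0 < γ) (hγ₁ : γ < 1) {π : State → Fin 2}
    (hπ : IsKG γ π) : SwitchesAfterRise γ π := by
  obtain ⟨B, hB, N, hN⟩ := exists_premium_le hγ₀ hγ₁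
  have hk : 0 < γ / (1 - γ) := div_pos hγ₀ (by linarith)
  have hm := meanPosPart_pos
  set k := γ / (1 - γ) with hkdef
  set c₀ := k * meanPosPart with hc₀
  have hc₀0 : 0 < c₀ := by positivity
  -- `k c₀` pays for the quadratic error term of `expectedExcess_sub_ge`, and `1` for strictness
  set A := k * c₀ + 1 with hA
  have hA0 : 0 < A := by positivity
  obtain ⟨M, hM⟩ := exists_nat_ge (N + A + (1 / 2 + B) + (2 * A + 1) / B + 1)
  have hfrac : 0 < (2 * A + 1) / B := by positivity
  have hN0 : (0 : ℝ) ≤ N := Nat.cast_nonneg N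
  have hM1 : 1 ≤ (M : ℝ) := by linarith
  have hM1' : 1 ≤ M := by exact_mod_cast hM1
  have hNM : N ≤ M := by exact_mod_cast (by linarith : (N : ℝ) ≤ M)
  have hMA : A ≤ (M : ℝ) ^ 2 := by nlinarith
  -- `r n` is the new mean of the pulled arm; the error term has `M`, not `n`, so that it telescopes
  set r : ℕ → ℝ := fun n => c₀ * (1 - A / M ^ 2) * (stepSd n - stepSd (n + 1)) with hr
  have hfac0 : 0 ≤ 1 - A / (M : ℝ) ^ 2 := by
    rw [sub_nonneg, div_le_one (by positivity)]; exact hMA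
  obtain ⟨n, hMn, hlt⟩ : ∃ n, M ≤ n ∧ premium γ n - premium γ (n + 1) < r n := by
    by_contra! hcon
    have h1 := le_of_forall_sub_succ_le (a := premium γ)
      (b := fun n => c₀ * (1 - A / M ^ 2) * stepSd n) (N := M)
      (fun n hn => premium_nonneg hγ₀ hγ₁ (hM1'.trans hn))
      (by simpa using tendsto_stepSd.const_mul (c₀ * (1 - A / (M : ℝ) ^ 2)))
      (fun n hn => by rw [← mul_sub]; exact hcon n hn)
    have h2 := hN M hNM
    have h3 : 1 / ((M : ℝ) + 1 / 2 + B) < (1 - A / M ^ 2) * (1 / (M + 1 / 2)) := by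
      have h4 : A * (M + 1 / 2 + B) < B * (M : ℝ) ^ 2 := by
        have h5 : 2 * A + 1 ≤ M * B := by rw [← div_le_iff₀ hB]; linarith
        have h6 : (1 / 2 + B) ≤ M := by linarith
        nlinarith
      rw [one_sub_div (by positivity), div_mul_div_comm,
        div_lt_div_iff₀ (by positivity) (by positivity)]
      nlinarith
    have h7 := mul_le_mul_of_nonneg_left (one_div_add_half_le_stepSd hM1') hfac0
    have h8 := mul_lt_mul_of_pos_left (h3.trans_le h7) hc₀0
    rw [mul_one_div] at h8
    linarith
  have hn1 : 1 ≤ n := hM1'.trans hMn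
  have hn0 : (0 : ℝ) < n := by exact_mod_cast hn1
  have hMn' : (M : ℝ) ≤ n := by exact_mod_cast hMn
  have hsd := stepSd_pos (Nat.le_succ_of_le hn1)
  have hdiff : 0 < stepSd n - stepSd (n + 1) := sub_pos.2 (stepSd_succ_lt hn1)
  have hr0 : 0 ≤ r n := by positivity
  have hrle : r n / stepSd (n + 1) ≤ c₀ / M := by
    have h1 : r n ≤ c₀ * (stepSd n - stepSd (n + 1)) := by
      have : 0 ≤ A / (M : ℝ) ^ 2 := by positivity
      have := mul_nonneg (mul_nonneg hc₀0.le this) hdiff.le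
      simp only [hr]
      linarith
    calc r n / stepSd (n + 1) ≤ c₀ * (stepSd n - stepSd (n + 1)) / stepSd (n + 1) := by gcongr
      _ = c₀ * ((stepSd n - stepSd (n + 1)) / stepSd (n + 1)) := by ring
      _ ≤ c₀ * (1 / n) := mul_le_mul_of_nonneg_left (stepSd_ratio hn1) hc₀0.le
      _ ≤ c₀ * (1 / M) := by gcongr
      _ = c₀ / M := by ring
  have hgain : r n
      < k * (expectedExcess (r n) (stepSd n) - expectedExcess (r n) (stepSd (n + 1))) := by
    have h1 := expectedExcess_sub_ge hsd (sub_nonneg.1 hdiff.le) hr0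
    have h2 : (r n / stepSd (n + 1)) ^ 2 ≤ (c₀ / M) ^ 2 :=
      pow_le_pow_left₀ (by positivity) hrle 2
    have h3 : (stepSd n - stepSd (n + 1)) * (meanPosPart - (c₀ / M) ^ 2)
        ≤ (stepSd n - stepSd (n + 1)) * (meanPosPart - (r n / stepSd (n + 1)) ^ 2) := by
      gcongr
    refine lt_of_lt_of_le ?_ (mul_le_mul_of_nonneg_left (h3.trans h1) hk.le)
    have h4 : k * ((stepSd n - stepSd (n + 1)) * (meanPosPart - (c₀ / M) ^ 2))
        = r n + c₀ / M ^ 2 * (stepSd n - stepSd (n + 1)) := by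
      simp only [hr, hA, hc₀]
      field_simp
      ring
    have h5 : 0 < c₀ / M ^ 2 * (stepSd n - stepSd (n + 1)) := by positivity
    linarith
  lift n to ℕ+ using hn1
  refine switchesAfterRise_of_score hγ₀ hγ₁ hπ n (r n) hlt fun a b hab =>
    kgScore_pull_lt hr0 ?_ hab
  rw [← hkdef]
  linarith

end GaussianBandit

theorem mainTheorem6 (γ : ℝ) (hγ₀ : 0 < γ) (hγ₁ : γ < 1) :
    (∀ π : GaussianBandit.State → Fin 2, GaussianBandit.IsKG γ π →
      ¬ GaussianBandit.IndexConsistent γ π ∧ GaussianBandit.SwitchesAfterRise γ π) ∧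
    (∀ π : GaussianBandit.State → Fin 2, GaussianBandit.IsGIBL γ π →
      ¬ GaussianBandit.IndexConsistent γ π ∧ GaussianBandit.SwitchesAfterRise γ π) ∧
    (∀ π : GaussianBandit.State → Fin 2, GaussianBandit.IsGICG γ π →
      ¬ GaussianBandit.IndexConsistent γ π ∧ GaussianBandit.SwitchesAfterRise γ π) := by
  refine ⟨fun π hπ => ?_, fun π hπ => ?_, fun π hπ => ?_⟩
  · have h := GaussianBandit.switchesAfterRise_of_isKG hγ₀ hγ₁ hπ
    exact ⟨h.not_indexConsistent, h⟩
  · have h := GaussianBandit.switchesAfterRise_of_isGIBL hγ₀ hγ₁ hπ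
    exact ⟨h.not_indexConsistent, h⟩
  · have h := GaussianBandit.switchesAfterRise_of_isGICG hγ₀ hγ₁ hπ
    exact ⟨h.not_indexConsistent, h⟩
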